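/- For positive integers $p,q,n$, the biased clique game $\mathrm{Clique}_{(p,q)}(n)$ is played on the edges of the complete graph $K_n$, all uncoloured at the start. Alice (player 1) and Bob (player 2) alternate turns, Alice moving first. On each of her turns Alice colours $p$ uncoloured edges red, and on each of his turns Bob colours $q$ uncoloured edges blue; a player facing fewer uncoloured edges than that colours all of them. When all edges are coloured, let $a$ and $b$ be the clique numbers of the graphs on the vertex set of $K_n$ formed by the red and by the blue edges, respectively. The game is won by player 2 if Bob has a strategy which guarantees $b>a$ at the end, however Alice plays. There is an absolute constant $c>0$ such that for all positive integers $p,q$ with $q>cp^2$ there is an $n_0=n_0(p,q)$ such that for every $n\ge n_0$ the game $\mathrm{Clique}_{(p,q)}(n)$ is won by player 2. -/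

import Mathlib

namespace CliqueGame

/-- A position of the edge-colouring game: the edges coloured red (by Alice, the first player)
and the edges coloured blue (by Bob, the second player) so far. -/
structure Position (V : Type*) where
  red : Finset (Sym2 V)
  blue : Finset (Sym2 V)

section

variable {V : Type*} [Fintype V] [DecidableEq V] (G : SimpleGraph V) [DecidableRel G.Adj]

/-- The edges of the board `G` that have not been coloured yet. -/
def uncoloured (P : Position V) : Finset (Sym2 V) :=
  G.edgeFinset \ (P.red ∪ P.blue)

/-- In a turn with bias `m` a player colours a set `M` of exactly `m` uncoloured edges, or all of
the uncoloured edges if fewer than `m` are left. -/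
def IsMove (m : ℕ) (P : Position V) (M : Finset (Sym2 V)) : Prop :=
  M ⊆ uncoloured G P ∧ M.card = min m (uncoloured G P).card

/-- Alice colours the edges of `M` red. -/
def Position.addRed (P : Position V) (M : Finset (Sym2 V)) : Position V :=
  ⟨P.red ∪ M, P.blue⟩

/-- Bob colours the edges of `M` blue. -/
def Position.addBlue (P : Position V) (M : Finset (Sym2 V)) : Position V :=
  ⟨P.red, P.blue ∪ M⟩

/-- A strategy of Bob with bias `q`: in every position it names a legal move for Bob. -/
def IsStrategy (q : ℕ) (σ : Position V → Finset (Sym2 V)) : Prop :=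
  ∀ P : Position V, IsMove G q P (σ P)

/-- The positions with Alice to move that can arise when Alice moves first, colours `p` edges per
turn in an arbitrary way, and Bob answers by `σ`. Once Alice has coloured the last edge, Bob's
answer is empty, so every completed play ends in such a position. -/
inductive Reachable (p : ℕ) (σ : Position V → Finset (Sym2 V)) : Position V → Prop
  | start : Reachable p σ ⟨∅, ∅⟩
  | round (P : Position V) (M : Finset (Sym2 V)) (hP : Reachable p σ P) (hM : IsMove G p P M) :
      Reachable p σ ((P.addRed M).addBlue (σ (P.addRed M)))

/-- The `(p, q)`-biased clique game on `G` is won by the second player: Bob has a strategy such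
that, whatever Alice does, when all edges are coloured the clique number of the blue graph
strictly exceeds the clique number of the red graph. -/
def SecondPlayerWins (p q : ℕ) : Prop :=
  ∃ σ : Position V → Finset (Sym2 V), IsStrategy G q σ ∧
    ∀ P : Position V, Reachable G p σ P → uncoloured G P = ∅ →
      (SimpleGraph.fromEdgeSet (P.red : Set (Sym2 V))).cliqueNum <
        (SimpleGraph.fromEdgeSet (P.blue : Set (Sym2 V))).cliqueNum

end

end CliqueGame

open Finset

/-! Bob plays two games at once on the same board. Let `L = cliqueBound p n`, about `2p log₂ n`.
With one edge per turn he keeps Alice from a red `K_L`, by the biased Erdős–Selfridge potential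
(`Safe.step`). This works because `L.choose 2 / p = L (⌊log₂ n⌋ + 1)`, so the weight of a full
clique exceeds twice the number of `L`-sets (`two_mul_choose_lt`). With the other `r = q - 1` edges
he builds a blue `K_L` greedily (`Building.step`): he joins the latest clique vertex to candidates,
`r` per turn, while Alice spoils at most `p` of them per turn. Each clique vertex thus keeps about
`r / (r + p)` of the candidates. Since `r ≥ 100p²`, after `L` such rounds at least `n ^ (7/8) / 4`
or so remain, because `L · p / r` is a small multiple of `log n`; this is where `q > cp²` is needed.
Only `O(pnL)` red edges appear meanwhile, so some candidate always has few red edges to the others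
and can be the next clique vertex. -/

namespace CliqueGame

/-! ### Biased Erdős–Selfridge: stopping Alice with one edge per turn. -/

section Breaker

variable {α : Type*} [DecidableEq α]

/-- The biased Erdős–Selfridge potential: the members of `F` that do not meet `B`, weighted by
`2 ^ (r / p)`, where `r` is the number of their elements in `R`. -/
noncomputable def potential (F : Finset (Finset α)) (p : ℕ) (R B : Finset α) : ℝ :=
  ∑ A ∈ F with Disjoint A B, (2 : ℝ) ^ ((#(A ∩ R) : ℝ) / p)

/-- The part of the potential that comes from the sets containing `e`. -/
noncomputable def danger (F : Finset (Finset α)) (p : ℕ) (R B : Finset α) (e : α) : ℝ :=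
  ∑ A ∈ F with Disjoint A B, if e ∈ A then (2 : ℝ) ^ ((#(A ∩ R) : ℝ) / p) else 0

lemma danger_nonneg (F : Finset (Finset α)) (p : ℕ) (R B : Finset α) (e : α) :
    0 ≤ danger F p R B e :=
  sum_nonneg fun A _ => by split_ifs <;> positivity

lemma danger_le_potential (F : Finset (Finset α)) (p : ℕ) (R B : Finset α) (e : α) :
    danger F p R B e ≤ potential F p R B :=
  sum_le_sum fun A _ => by
    split_ifs
    · exact le_rfl
    · positivity

lemma potential_anti (F : Finset (Finset α)) (p : ℕ) (R : Finset α) {B B' : Finset α}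
    (h : B ⊆ B') : potential F p R B' ≤ potential F p R B :=
  sum_le_sum_of_subset_of_nonneg
    (fun A hA => by
      simp only [mem_filter] at hA ⊢
      exact ⟨hA.1, hA.2.mono_right h⟩)
    fun A _ _ => by positivity

lemma danger_anti (F : Finset (Finset α)) (p : ℕ) (R : Finset α) {B B' : Finset α}
    (h : B ⊆ B') (e : α) : danger F p R B' e ≤ danger F p R B e :=
  sum_le_sum_of_subset_of_nonneg
    (fun A hA => by
      simp only [mem_filter] at hA ⊢
      exact ⟨hA.1, hA.2.mono_right h⟩)
    fun A _ _ => by split_ifs <;> positivity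

lemma potential_insert_add_danger (F : Finset (Finset α)) (p : ℕ) (R B : Finset α) (y : α) :
    potential F p R (insert y B) + danger F p R B y = potential F p R B := by
  have h : F.filter (fun A => Disjoint A (insert y B)) =
      (F.filter (fun A => Disjoint A B)).filter (fun A => ¬ y ∈ A) := by
    ext A
    simp only [mem_filter, disjoint_insert_right]
    tauto
  rw [potential, danger, potential, h, ← sum_filter, add_comm]
  exact sum_filter_add_sum_filter_not _ _ _

/-- A set gaining `j ≤ p` red elements has its weight multiplied by `2 ^ (j / p) ≤ 1 + j / p`. Hence
the increase is at most the sum of the old dangers over `M`, divided by `p`. -/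
lemma potential_union_le {F : Finset (Finset α)} {p : ℕ} (hp : 1 ≤ p) {R B M : Finset α} {m : ℝ}
    (hM : #M ≤ p) (hm : 0 ≤ m) (hd : ∀ e ∈ M, danger F p R B e ≤ m) :
    potential F p (R ∪ M) B ≤ potential F p R B + m := by
  have hp' : (0 : ℝ) < p := by exact_mod_cast hp
  have key : ∀ A : Finset α, (2 : ℝ) ^ ((#(A ∩ (R ∪ M)) : ℝ) / p) ≤
      (2 : ℝ) ^ ((#(A ∩ R) : ℝ) / p) +
        (∑ e ∈ M, if e ∈ A then (2 : ℝ) ^ ((#(A ∩ R) : ℝ) / p) else 0) / p := by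
    intro A
    have hcard : #(A ∩ (R ∪ M)) ≤ #(A ∩ R) + #(A ∩ M) := by
      rw [inter_union_distrib_left]
      exact card_union_le _ _
    have hAM : #(A ∩ M) ≤ p := (card_le_card inter_subset_right).trans hM
    have hsum : (∑ e ∈ M, if e ∈ A then (2 : ℝ) ^ ((#(A ∩ R) : ℝ) / p) else 0) =
        #(A ∩ M) * (2 : ℝ) ^ ((#(A ∩ R) : ℝ) / p) := by
      rw [← sum_filter, sum_const, nsmul_eq_mul, filter_mem_eq_inter, inter_comm]
    -- The chord bound for `2 ^ x` on `[0, 1]`; this is where `#M ≤ p` matters.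
    have hbern : (2 : ℝ) ^ ((#(A ∩ M) : ℝ) / p) ≤ 1 + (#(A ∩ M) : ℝ) / p := by
      have := rpow_one_add_le_one_add_mul_self (s := 1) (p := (#(A ∩ M) : ℝ) / p) (by norm_num)
        (by positivity) (by rw [div_le_one hp']; exact_mod_cast hAM)
      norm_num at this
      exact this
    calc (2 : ℝ) ^ ((#(A ∩ (R ∪ M)) : ℝ) / p)
        ≤ (2 : ℝ) ^ ((#(A ∩ R) : ℝ) / p + (#(A ∩ M) : ℝ) / p) := by
          apply Real.rpow_le_rpow_of_exponent_le (by norm_num)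
          rw [← add_div]
          gcongr
          exact_mod_cast hcard
      _ = (2 : ℝ) ^ ((#(A ∩ R) : ℝ) / p) * (2 : ℝ) ^ ((#(A ∩ M) : ℝ) / p) :=
          Real.rpow_add (by norm_num) _ _
      _ ≤ (2 : ℝ) ^ ((#(A ∩ R) : ℝ) / p) * (1 + (#(A ∩ M) : ℝ) / p) := by gcongr
      _ = _ := by rw [hsum]; ring
  calc potential F p (R ∪ M) B
      ≤ ∑ A ∈ F with Disjoint A B, ((2 : ℝ) ^ ((#(A ∩ R) : ℝ) / p) +
        (∑ e ∈ M, if e ∈ A then (2 : ℝ) ^ ((#(A ∩ R) : ℝ) / p) else 0) / p) :=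
        sum_le_sum fun A _ => key A
    _ = potential F p R B + (∑ e ∈ M, danger F p R B e) / p := by
        rw [sum_add_distrib, ← sum_div, sum_comm]
        rfl
    _ ≤ potential F p R B + m := by
        gcongr
        rw [div_le_iff₀ hp']
        calc ∑ e ∈ M, danger F p R B e ≤ ∑ _e ∈ M, m := sum_le_sum hd
          _ = #M * m := by rw [sum_const, nsmul_eq_mul]
          _ ≤ p * m := by gcongr
          _ = m * p := mul_comm _ _

/-- The potential is so small that it stays below `C` whatever Alice does in her next turn on
the board `E`. -/
def Safe (F : Finset (Finset α)) (E : Finset α) (p : ℕ) (C : ℝ) (R B : Finset α) : Prop :=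
  ∃ m : ℝ, 0 ≤ m ∧ (∀ e ∈ E \ (R ∪ B), danger F p R B e ≤ m) ∧ potential F p R B + m ≤ C

lemma safe_empty (F : Finset (Finset α)) (E : Finset α) (p : ℕ) :
    Safe F E p (2 * #F) ∅ ∅ := by
  have h : potential F p ∅ ∅ = #F := by simp [potential]
  refine ⟨#F, by positivity, fun e _ => ?_, by rw [h]; linarith⟩
  rw [← h]
  exact danger_le_potential _ _ _ _ _

/-- Taking an edge of maximal danger after Alice's turn lowers the potential by exactly that danger,
which then serves as the new bound `m`. Further blue edges only help, so `B'` is arbitrary above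
`Y`. -/
lemma Safe.step {F : Finset (Finset α)} {E : Finset α} {p : ℕ} (hp : 1 ≤ p) {C : ℝ}
    {R B M : Finset α} (h : Safe F E p C R B) (hME : M ⊆ E \ (R ∪ B)) (hM : #M ≤ p) :
    ∃ Y ⊆ E \ (R ∪ M ∪ B), #Y ≤ 1 ∧ ∀ B', B ⊆ B' → Y ⊆ B' → Safe F E p C (R ∪ M) B' := by
  obtain ⟨m, hm0, hm, hC⟩ := h
  have hpot : potential F p (R ∪ M) B ≤ C :=
    (potential_union_le hp hM hm0 fun e he => hm e (hME he)).trans hC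
  rcases (E \ (R ∪ M ∪ B)).eq_empty_or_nonempty with h0 | h0
  · refine ⟨∅, empty_subset _, by simp, fun B' hB _ => ⟨0, le_rfl, fun e he => ?_, ?_⟩⟩
    · have : e ∈ E \ (R ∪ M ∪ B) :=
        sdiff_subset_sdiff subset_rfl (union_subset_union_right hB) he
      exact absurd (h0 ▸ this) (notMem_empty e)
    · rw [add_zero]
      exact (potential_anti F p _ hB).trans hpot
  · obtain ⟨y, hy, hmax⟩ := exists_max_image _ (danger F p (R ∪ M) B) h0
    refine ⟨{y}, by simpa using hy, by simp, fun B' hB hyB => ?_⟩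
    refine ⟨danger F p (R ∪ M) B y, danger_nonneg _ _ _ _ _, fun e he => ?_, ?_⟩
    · exact (danger_anti F p _ hB e).trans
        (hmax e (sdiff_subset_sdiff subset_rfl (union_subset_union_right hB) he))
    · have hins : insert y B ⊆ B' := insert_subset (by simpa using hyB) hB
      have h1 := potential_anti F p (R ∪ M) hins
      have h2 := potential_insert_add_danger F p (R ∪ M) B y
      linarith

/-- In a safe position no member of `F` is contained in `R`, if `C` is below its weight. -/
lemma Safe.not_subset {F : Finset (Finset α)} {E : Finset α} {p : ℕ} {C : ℝ} {R B A : Finset α}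
    (h : Safe F E p C R B) (hRB : Disjoint R B) (hA : A ∈ F)
    (hC : C < (2 : ℝ) ^ ((#A : ℝ) / p)) : ¬ A ⊆ R := by
  intro hAR
  obtain ⟨m, hm0, -, hm⟩ := h
  have : (2 : ℝ) ^ ((#A : ℝ) / p) ≤ potential F p R B := by
    have := single_le_sum (f := fun A : Finset α => (2 : ℝ) ^ ((#(A ∩ R) : ℝ) / p))
      (s := F.filter (fun A => Disjoint A B)) (fun A _ => by positivity)
      (mem_filter.2 ⟨hA, hRB.mono_left hAR⟩)
    rwa [inter_eq_left.2 hAR] at this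
  linarith

end Breaker

/-! ### Building a blue clique with `r` edges per turn. -/

section Maker

variable {V : Type*} [DecidableEq V]

/-- Some vertex of `N` is incident with few edges of `R` inside `N`. -/
lemma exists_card_filter_mul_card_le (R : Finset (Sym2 V)) {N : Finset V} (hN : N.Nonempty) :
    ∃ w ∈ N, #{u ∈ N | s(w, u) ∈ R} * #N ≤ 2 * #R := by
  by_contra! h
  -- Handshake count: each red edge comes from at most two ordered pairs.
  have h1 : ∑ w ∈ N, #{u ∈ N | s(w, u) ∈ R} ≤ 2 * #R := by
    rw [← card_sigma]
    refine card_le_mul_card_image_of_maps_to (f := fun x : (_ : V) × V => s(x.1, x.2)) ?_ 2 ?_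
    · intro x hx
      simp only [mem_sigma, mem_filter] at hx
      exact hx.2.2
    · intro e _
      induction e with
      | _ a b =>
        refine (card_le_card (t := {⟨a, b⟩, ⟨b, a⟩}) ?_).trans card_le_two
        rintro ⟨x, y⟩ hx
        simp only [mem_filter, Sym2.eq_iff] at hx
        rcases hx.2 with ⟨rfl, rfl⟩ | ⟨rfl, rfl⟩ <;> simp
  have h2 : ∑ _w ∈ N, 2 * #R < ∑ w ∈ N, #{u ∈ N | s(w, u) ∈ R} * #N := sum_lt_sum_of_nonempty hN h
  rw [sum_const, smul_eq_mul, ← sum_mul, mul_comm] at h2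
  exact absurd h1 (not_le.2 (lt_of_mul_lt_mul_right h2 (Nat.zero_le _)))

lemma card_filter_mk_mem_le (M : Finset (Sym2 V)) (U : Finset V) (v : V) :
    #{u ∈ U | s(v, u) ∈ M} ≤ #M :=
  card_le_card_of_injOn (fun u => s(v, u)) (fun _ hu => (mem_filter.1 hu).2)
    fun _ _ _ _ hxy => Sym2.congr_right.1 hxy

/-- A stage of Bob's construction of a blue clique: `S` is a blue clique and `v` its latest vertex;
the vertices of `N` are joined in blue to all of `S`, those of `U` to all of `S` but `v`, and their
edges to `v` are not red. At most `p * τ` edges are red. The target `a k` for the number of vertices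
available when the clique has `k` vertices is met, if vertices of `N` count `(r + p) / r` times. -/
structure IsStage (p r n : ℕ) (a : ℕ → ℝ) (P : Position V) (τ : ℕ) (S N U : Finset V) (v : V) :
    Prop where
  mem : v ∈ S
  clique : ∀ x ∈ S, ∀ y ∈ S, x ≠ y → s(x, y) ∈ P.blue
  joined : ∀ x ∈ S, ∀ u ∈ N, s(x, u) ∈ P.blue
  pending : ∀ x ∈ S, x ≠ v → ∀ u ∈ U, s(x, u) ∈ P.blue
  notMem_red : ∀ u ∈ U, s(v, u) ∉ P.red
  disjoint_joined : Disjoint S N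
  disjoint_pending : Disjoint S U
  disjoint : Disjoint N U
  card_red : #P.red ≤ p * τ
  time : τ ≤ (n + 1) * #S + #N
  size : r * a #S ≤ r * #U + (r + p) * #N

variable [Fintype V]

/-- `U` loses `r` vertices to `N` and at most `p` to Alice, so `r * #U + (r + p) * #N` does not
decrease. -/
lemma IsStage.extend {p r n τ : ℕ} {a : ℕ → ℝ} {P : Position V} {S N U : Finset V} {v : V}
    (h : IsStage p r n a P τ S N U v) (hr : 1 ≤ r) {M : Finset (Sym2 V)} (hM : #M ≤ p)
    (hU : r ≤ #{u ∈ U | s(v, u) ∉ M}) :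
    ∃ X ⊆ uncoloured ⊤ (P.addRed M), #X ≤ r ∧
      ∀ B, X ⊆ B → ∃ N' U', IsStage p r n a ((P.addRed M).addBlue B) (τ + 1) S N' U' v := by
  obtain ⟨W, hWU, hW⟩ := exists_subset_card_eq hU
  have hWU' : W ⊆ U := hWU.trans (filter_subset _ _)
  have hcard : #{u ∈ U | s(v, u) ∉ M} + p ≥ #U := by
    have := card_filter_add_card_filter_not (s := U) (fun u => s(v, u) ∈ M)
    have := card_filter_mk_mem_le M U v
    omega
  have hnotMem : ∀ u ∈ U.filter (fun u => s(v, u) ∉ M), s(v, u) ∉ P.red ∪ M := by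
    intro u hu
    rw [mem_filter] at hu
    rw [mem_union, not_or]
    exact ⟨h.notMem_red u hu.1, hu.2⟩
  refine ⟨W.image (fun u => s(v, u)) \ P.blue, ?_, ?_, fun B hB => ?_⟩
  · intro e he
    rw [mem_sdiff, mem_image] at he
    obtain ⟨⟨u, hu, rfl⟩, hb⟩ := he
    have hne : v ≠ u := fun hvu =>
      disjoint_left.1 h.disjoint_pending h.mem (hvu ▸ hWU' hu)
    have := hnotMem u (hWU hu)
    simp only [uncoloured, Position.addRed, mem_sdiff, SimpleGraph.mem_edgeFinset,
      SimpleGraph.mem_edgeSet, SimpleGraph.top_adj]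
    refine ⟨hne, ?_⟩
    rw [mem_union, not_or]
    exact ⟨this, hb⟩
  · exact (card_le_card sdiff_subset).trans (card_image_le.trans hW.le)
  · have hNW : Disjoint N W := h.disjoint.mono_right hWU'
    have hcN : #(N ∪ W) = #N + r := by rw [card_union_of_disjoint hNW, hW]
    have hcU : #({u ∈ U | s(v, u) ∉ M} \ W) + r = #{u ∈ U | s(v, u) ∉ M} := by
      rw [← hW]; exact card_sdiff_add_card_eq_card hWU
    have hsub : {u ∈ U | s(v, u) ∉ M} \ W ⊆ U := sdiff_subset.trans (filter_subset _ _)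
    refine ⟨N ∪ W, {u ∈ U | s(v, u) ∉ M} \ W, h.mem, ?_, ?_, ?_, ?_, ?_, ?_, ?_, ?_, ?_, ?_⟩
    · exact fun x hx y hy hxy => mem_union_left _ (h.clique x hx y hy hxy)
    · intro x hx u hu
      rcases mem_union.1 hu with hu | hu
      · exact mem_union_left _ (h.joined x hx u hu)
      · by_cases hxv : x = v
        · subst hxv
          by_cases hb : s(x, u) ∈ P.blue
          · exact mem_union_left _ hb
          · exact mem_union_right _ (hB (mem_sdiff.2 ⟨mem_image_of_mem _ hu, hb⟩))
        · exact mem_union_left _ (h.pending x hx hxv u (hWU' hu))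
    · exact fun x hx hxv u hu => mem_union_left _ (h.pending x hx hxv u (hsub hu))
    · exact fun u hu => hnotMem u (sdiff_subset hu)
    · exact disjoint_union_right.2 ⟨h.disjoint_joined, h.disjoint_pending.mono_right hWU'⟩
    · exact h.disjoint_pending.mono_right hsub
    · exact disjoint_union_left.2 ⟨h.disjoint.mono_right hsub, disjoint_sdiff⟩
    · have := h.card_red
      have := card_union_le P.red M
      change #(P.red ∪ M) ≤ _
      rw [mul_add, mul_one]
      omega
    · have := h.time
      omega
    · have h1 := h.size
      have h2 : (#({u ∈ U | s(v, u) ∉ M} \ W) : ℝ) + r + p ≥ #U := by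
        exact_mod_cast hcU ▸ hcard
      have h3 : (0 : ℝ) ≤ r := by positivity
      rw [hcN]
      push_cast
      nlinarith [mul_le_mul_of_nonneg_left h2 h3]

/-- Once `U` is nearly exhausted, `size` bounds `#N` from below. A vertex `w` of `N` with few red
edges inside `N` joins the clique, and the rest of `N`, minus the red neighbours of `w`, becomes the
new `U`. No blue edge is spent, so `B` is arbitrary. -/
lemma IsStage.next {p r n τ L : ℕ} {a : ℕ → ℝ} {P : Position V} {S N U : Finset V} {v : V}
    (h : IsStage p r n a P τ S N U v) (hn : Fintype.card V = n) {M : Finset (Sym2 V)} (hM : #M ≤ p)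
    (hS : #S < L) (hU : #{u ∈ U | s(v, u) ∉ M} ≤ r)
    (ha : ∀ k < L, ∀ ν : ℕ, r * a k ≤ r * (r + p) + (r + p) * ν →
      0 < ν ∧ a (k + 1) ≤ ν - 1 - 2 * p * (n + 1) * L / ν) (B : Finset (Sym2 V)) :
    ∃ w ∉ S, ∃ U', IsStage p r n a ((P.addRed M).addBlue B) (τ + 1) (insert w S) ∅ U' w := by
  have hcard : #U ≤ r + p := by
    have := card_filter_add_card_filter_not (s := U) (fun u => s(v, u) ∈ M)
    have := card_filter_mk_mem_le M U v
    omega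
  have hN := ha #S hS #N (h.size.trans (by gcongr; exact_mod_cast hcard))
  have hRM : #(P.red ∪ M) ≤ p * (τ + 1) := by
    have := h.card_red
    have := card_union_le P.red M
    rw [mul_add, mul_one]
    omega
  have htime : τ + 1 ≤ (n + 1) * (#S + 1) := by
    have h1 := h.time
    have h2 : #N ≤ n := hn ▸ card_le_univ N
    rw [mul_add, mul_one]
    omega
  obtain ⟨w, hw, hdeg⟩ := exists_card_filter_mul_card_le (P.red ∪ M) (card_pos.1 hN.1)
  have hwS : w ∉ S := fun hwS => disjoint_left.1 h.disjoint_joined hwS hw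
  refine ⟨w, hwS, {u ∈ N.erase w | s(w, u) ∉ P.red ∪ M}, mem_insert_self _ _,
    ?_, ?_, ?_, ?_, ?_, ?_, ?_, ?_, ?_, ?_⟩
  · intro x hx y hy hxy
    refine mem_union_left _ ?_
    rcases mem_insert.1 hx with rfl | hxS <;> rcases mem_insert.1 hy with rfl | hyS
    · exact absurd rfl hxy
    · rw [Sym2.eq_swap]
      exact h.joined y hyS x hw
    · exact h.joined x hxS y hw
    · exact h.clique x hxS y hyS hxy
  · simp
  · intro x hx hxw u hu
    exact mem_union_left _
      (h.joined x (mem_of_mem_insert_of_ne hx hxw) u (mem_of_mem_erase (mem_filter.1 hu).1))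
  · exact fun u hu => (mem_filter.1 hu).2
  · simp
  · rw [disjoint_insert_left]
    exact ⟨by simp, h.disjoint_joined.mono_right ((filter_subset _ _).trans (erase_subset _ _))⟩
  · simp
  · exact hRM
  · rw [card_insert_of_notMem hwS, card_empty]
    exact htime
  · have h1 : #N ≤ #{u ∈ N.erase w | s(w, u) ∉ P.red ∪ M} + 1 +
        #{u ∈ N | s(w, u) ∈ P.red ∪ M} := by
      have h2 := card_filter_add_card_filter_not (s := N.erase w) (fun u => s(w, u) ∈ P.red ∪ M)
      have h3 := card_erase_add_one hw
      have h4 : #{u ∈ N.erase w | s(w, u) ∈ P.red ∪ M} ≤ #{u ∈ N | s(w, u) ∈ P.red ∪ M} :=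
        card_le_card (filter_subset_filter _ (erase_subset _ _))
      omega
    have h5 : (#{u ∈ N | s(w, u) ∈ P.red ∪ M} : ℝ) ≤ 2 * p * (n + 1) * L / #N := by
      rw [le_div_iff₀ (by exact_mod_cast hN.1)]
      have h6 : #{u ∈ N | s(w, u) ∈ P.red ∪ M} * #N ≤ 2 * p * (n + 1) * L :=
        calc _ ≤ 2 * #(P.red ∪ M) := hdeg
          _ ≤ 2 * (p * ((n + 1) * L)) := by
            gcongr
            refine hRM.trans ?_
            gcongr
            exact htime.trans (by gcongr; exact hS)
          _ = _ := by ring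
      exact_mod_cast h6
    have h7 : (#N : ℝ) ≤ #{u ∈ N.erase w | s(w, u) ∉ P.red ∪ M} + 1 +
        #{u ∈ N | s(w, u) ∈ P.red ∪ M} := by exact_mod_cast h1
    rw [card_insert_of_notMem hwS, card_empty, Nat.cast_zero, mul_zero, add_zero]
    gcongr
    linarith [hN.2]

/-- Bob has a blue clique with `L` vertices, or a stage on the way to it. -/
def Building (p r n L : ℕ) (a : ℕ → ℝ) (P : Position V) (τ : ℕ) : Prop :=
  (∃ S : Finset V, #S = L ∧ ∀ x ∈ S, ∀ y ∈ S, x ≠ y → s(x, y) ∈ P.blue) ∨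
    ∃ S N U v, #S < L ∧ IsStage p r n a P τ S N U v

lemma Building.step {p r n τ L : ℕ} {a : ℕ → ℝ} {P : Position V}
    (h : Building p r n L a P τ) (hr : 1 ≤ r) (hn : Fintype.card V = n) {M : Finset (Sym2 V)}
    (hM : #M ≤ p)
    (ha : ∀ k < L, ∀ ν : ℕ, r * a k ≤ r * (r + p) + (r + p) * ν →
      0 < ν ∧ a (k + 1) ≤ ν - 1 - 2 * p * (n + 1) * L / ν) :
    ∃ X ⊆ uncoloured ⊤ (P.addRed M), #X ≤ r ∧
      ∀ B, X ⊆ B → Building p r n L a ((P.addRed M).addBlue B) (τ + 1) := by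
  rcases h with ⟨S, hS, hc⟩ | ⟨S, N, U, v, hS, h⟩
  · exact ⟨∅, empty_subset _, by simp, fun B _ =>
      Or.inl ⟨S, hS, fun x hx y hy hxy => mem_union_left _ (hc x hx y hy hxy)⟩⟩
  rcases le_total r #{u ∈ U | s(v, u) ∉ M} with hU | hU
  · obtain ⟨X, hX, hXr, hstage⟩ := h.extend hr hM hU
    refine ⟨X, hX, hXr, fun B hB => ?_⟩
    obtain ⟨N', U', h'⟩ := hstage B hB
    exact Or.inr ⟨S, N', U', v, hS, h'⟩
  · refine ⟨∅, empty_subset _, by simp, fun B _ => ?_⟩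
    obtain ⟨w, hw, U', h'⟩ := h.next hn hM hS hU ha B
    have hcard := card_insert_of_notMem hw
    rcases (show #S + 1 ≤ L from hS).eq_or_lt with hL | hL
    · exact Or.inl ⟨insert w S, hcard.trans hL, h'.clique⟩
    · exact Or.inr ⟨insert w S, ∅, U', w, hcard.trans_lt hL, h'⟩

/-- On a full board the construction could go on with empty moves without changing the position. But
each step raises `(n + 1) * #S + #N`, which is bounded, so the clique must already be complete. -/
lemma Building.exists_clique {p r n τ L : ℕ} {a : ℕ → ℝ} {P : Position V}
    (h : Building p r n L a P τ) (hr : 1 ≤ r) (hn : Fintype.card V = n)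
    (ha : ∀ k < L, ∀ ν : ℕ, r * a k ≤ r * (r + p) + (r + p) * ν →
      0 < ν ∧ a (k + 1) ≤ ν - 1 - 2 * p * (n + 1) * L / ν)
    (hP : uncoloured ⊤ P = ∅) :
    ∃ S : Finset V, #S = L ∧ ∀ x ∈ S, ∀ y ∈ S, x ≠ y → s(x, y) ∈ P.blue := by
  have hforever : ∀ t, Building p r n L a P (τ + t) := by
    intro t
    induction t with
    | zero => exact h
    | succ t ih =>
      obtain ⟨X, hX, -, hB⟩ := ih.step hr hn (M := ∅) (by simp) ha
      have hred : P.addRed ∅ = P := by simp [Position.addRed]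
      have hblue : P.addBlue ∅ = P := by simp [Position.addBlue]
      rw [hred] at hX hB
      rw [hP] at hX
      simpa only [hblue, add_assoc] using hB ∅ hX
  rcases hforever ((n + 1) * L + n + 1) with hc | ⟨S, N, U, v, hS, h'⟩
  · exact hc
  · have h1 := h'.time
    have h2 : #N ≤ n := hn ▸ card_le_univ N
    have h3 : (n + 1) * #S ≤ (n + 1) * L := by gcongr
    omega

lemma building_start {p r n L : ℕ} {a : ℕ → ℝ} (hn : Fintype.card V = n) (hn0 : 0 < n) (hL : 1 < L)
    (ha : a 1 ≤ n - 1) : Building (V := V) p r n L a ⟨∅, ∅⟩ 0 := by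
  obtain ⟨v⟩ : Nonempty V := Fintype.card_pos_iff.1 (hn ▸ hn0)
  refine Or.inr ⟨{v}, ∅, univ.erase v, v, by simpa, ?_⟩
  refine ⟨by simp, ?_, by simp, ?_, by simp, by simp, by simp, by simp, by simp, by simp, ?_⟩
  · intro x hx y hy hxy
    rw [mem_singleton] at hx hy
    exact absurd (hx.trans hy.symm) hxy
  · intro x hx hxv
    exact absurd (mem_singleton.1 hx) hxv
  · rw [card_singleton, card_erase_of_mem (mem_univ _), card_univ, hn, Nat.cast_pred hn0]
    simp only [card_empty, Nat.cast_zero, mul_zero, add_zero]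
    gcongr

end Maker

/-! ### Numerical estimates. -/

/-- The number of candidate vertices that Bob keeps when his clique has `k` vertices. -/
noncomputable def target (p r n k : ℕ) : ℝ :=
  n * (1 - 2 * p / r) ^ k

lemma target_one_le {p r n : ℕ} (hp : 1 ≤ p) (hr : 1 ≤ r) (hn : r ≤ n) :
    target p r n 1 ≤ n - 1 := by
  have hr' : (0 : ℝ) < r := by exact_mod_cast hr
  have hp' : (1 : ℝ) ≤ p := by exact_mod_cast hp
  have hn' : (r : ℝ) ≤ n := by exact_mod_cast hn
  have : (1 : ℝ) ≤ n * (2 * p / r) := by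
    rw [← mul_div_assoc, le_div_iff₀ hr']
    nlinarith
  rw [target, pow_one]
  linarith

/-- Of the loss factor `1 - 2 * p / r`, one `p / r` pays for Alice's spoiling and the other for `r +
1` and the red neighbours, by `hL`. -/
lemma target_succ_le {p r n L : ℕ} (hp : 1 ≤ p) (hr : 100 * p ^ 2 ≤ r) (hn : 1 ≤ n)
    (hL : (r : ℝ) + 1 + 4 * p * (n + 1) * L / target p r n L ≤ target p r n L * (p / r)) :
    ∀ k < L, ∀ ν : ℕ, r * target p r n k ≤ r * (r + p) + (r + p) * ν →
      0 < ν ∧ target p r n (k + 1) ≤ ν - 1 - 2 * p * (n + 1) * L / ν := by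
  intro k hk ν hν
  have hp' : (1 : ℝ) ≤ p := by exact_mod_cast hp
  have hr' : (100 : ℝ) * p ^ 2 ≤ r := by exact_mod_cast hr
  have hn' : (0 : ℝ) < n := by exact_mod_cast hn
  have hr0 : (0 : ℝ) < r := by nlinarith
  have hx : (p : ℝ) / r ≤ 1 / 100 := by
    rw [div_le_div_iff₀ hr0 (by norm_num)]
    nlinarith
  have hx0 : (0 : ℝ) < p / r := by positivity
  have hθ : (2 : ℝ) * p / r = 2 * (p / r) := by ring
  set x : ℝ := p / r with hxdef
  have hpx : (p : ℝ) = x * r := by rw [hxdef]; field_simp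
  have hA0 : 0 < target p r n L := by
    rw [target, hθ]
    have : 0 < 1 - 2 * x := by linarith
    positivity
  have hAk : target p r n L ≤ target p r n k := by
    rw [target, target, hθ]
    gcongr n * ?_
    exact pow_le_pow_of_le_one (by linarith) (by linarith) hk.le
  have hsucc : target p r n (k + 1) = target p r n k * (1 - 2 * x) := by
    rw [target, target, hθ, pow_succ, mul_assoc]
  rw [hsucc]
  set A := target p r n L
  set b := target p r n k
  have hb0 : 0 < b := hA0.trans_le hAk
  have hb : (r : ℝ) + 1 + 4 * p * (n + 1) * L / b ≤ b * x :=
    calc (r : ℝ) + 1 + 4 * p * (n + 1) * L / b ≤ (r : ℝ) + 1 + 4 * p * (n + 1) * L / A := by gcongr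
      _ ≤ A * x := hL
      _ ≤ b * x := by gcongr
  have hν1 : b * (1 - x) - r ≤ ν := by
    have h1 : (r + p : ℝ) * (b * (1 - x) - r) ≤ (r + p) * ν := by
      have h2 : (r + p : ℝ) * (b * (1 - x) - r) = r * b - r * b * x ^ 2 - r * (r + p) := by
        rw [hpx]; ring
      rw [h2]
      have : 0 ≤ r * b * x ^ 2 := by positivity
      linarith
    exact le_of_mul_le_mul_left h1 (by positivity)
  have hq : 0 ≤ 4 * (p : ℝ) * (n + 1) * L / b := by positivity
  have hbx : b * x ≤ b * (1 / 100) := by gcongr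
  have hν2 : b / 2 ≤ ν := by linarith
  have hν0 : (0 : ℝ) < ν := by linarith
  refine ⟨by exact_mod_cast hν0, ?_⟩
  have h3 : 2 * (p : ℝ) * (n + 1) * L / ν ≤ 4 * p * (n + 1) * L / b :=
    calc 2 * (p : ℝ) * (n + 1) * L / ν ≤ 2 * (p : ℝ) * (n + 1) * L / (b / 2) := by gcongr
      _ = _ := by field_simp; ring
  linarith

/-- The size of the cliques that Alice cannot build. -/
def cliqueBound (p n : ℕ) : ℕ := 2 * p * (Nat.log 2 n + 1) + 1

lemma div_two_pow_le_target {p r n : ℕ} (hp : 1 ≤ p) (hr : 100 * p ^ 2 ≤ r) :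
    (n : ℝ) / (4 * 2 ^ (Nat.log 2 n / 8)) ≤ target p r n (cliqueBound p n) := by
  have hp' : (1 : ℝ) ≤ p := by exact_mod_cast hp
  have hr' : (100 : ℝ) * p ^ 2 ≤ r := by exact_mod_cast hr
  have hr0 : (0 : ℝ) < r := by nlinarith
  have hx : (2 : ℝ) * p / r * (16 * p) ≤ 1 / 2 := by
    rw [div_mul_eq_mul_div, div_le_div_iff₀ hr0 (by norm_num)]
    nlinarith
  have hx0 : (0 : ℝ) < 2 * p / r := by positivity
  have hx1 : (2 : ℝ) * p / r ≤ 1 / 2 := by nlinarith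
  -- Bernoulli: `16 * p` rounds lose at most half, as `32 * p ^ 2 / r ≤ 1 / 2`.
  have hbern : (1 : ℝ) / 2 ≤ (1 - 2 * p / r) ^ (16 * p) := by
    have := one_add_mul_le_pow (a := -(2 * p / r : ℝ)) (by linarith) (16 * p)
    rw [← sub_eq_add_neg] at this
    push_cast at this
    linarith
  have hle : cliqueBound p n ≤ 16 * p * (Nat.log 2 n / 8 + 2) := by
    have h1 : Nat.log 2 n + 2 ≤ 8 * (Nat.log 2 n / 8 + 2) := by omega
    calc cliqueBound p n ≤ 2 * p * (Nat.log 2 n + 2) := by rw [cliqueBound]; linarith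
      _ ≤ 2 * p * (8 * (Nat.log 2 n / 8 + 2)) := by gcongr
      _ = _ := by ring
  rw [target, div_eq_mul_inv]
  gcongr
  calc ((4 : ℝ) * 2 ^ (Nat.log 2 n / 8))⁻¹ = (1 / 2) ^ (Nat.log 2 n / 8 + 2) := by
        rw [pow_add, one_div, inv_pow, mul_inv]; norm_num; ring
    _ ≤ ((1 - 2 * p / r) ^ (16 * p)) ^ (Nat.log 2 n / 8 + 2) := by gcongr
    _ = (1 - 2 * p / r : ℝ) ^ (16 * p * (Nat.log 2 n / 8 + 2)) := (pow_mul _ _ _).symm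
    _ ≤ _ := pow_le_pow_of_le_one (by linarith) (by linarith) hle

/-- With `D = 2 ^ (log₂ n / 8)`, the target is at least `D ^ 7 / 4`, while the red loss is at most
`544 * p ^ 2 * D ^ 2`, where `544 = 4 · 2 · 17 · 4`. -/
lemma target_cliqueBound_large {p r n : ℕ} (hp : 1 ≤ p) (hr : 100 * p ^ 2 ≤ r)
    (hn : 2 ^ (8 * (4 * r * (r + 1 + 544 * p ^ 2))) ≤ n) :
    (r : ℝ) + 1 + 4 * p * (n + 1) * cliqueBound p n / target p r n (cliqueBound p n) ≤
      target p r n (cliqueBound p n) * (p / r) := by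
  have hp' : (1 : ℝ) ≤ p := by exact_mod_cast hp
  have hr' : (100 : ℝ) * p ^ 2 ≤ r := by exact_mod_cast hr
  have hr0 : (0 : ℝ) < r := by nlinarith
  have hn1 : 1 ≤ n := Nat.one_le_two_pow.trans hn
  have hn' : (1 : ℝ) ≤ n := by exact_mod_cast hn1
  have hA := div_two_pow_le_target (n := n) hp hr
  set A := target p r n (cliqueBound p n)
  set u := Nat.log 2 n / 8 with hu
  set D : ℝ := 2 ^ u with hD
  have hK : 4 * r * (r + 1 + 544 * p ^ 2) ≤ u := by
    have := Nat.le_log_of_pow_le (by norm_num) hn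
    omega
  have huD : (u : ℝ) + 1 ≤ D := by
    have : u + 1 ≤ 2 ^ u := Nat.lt_two_pow_self
    rw [hD]
    exact_mod_cast this
  have hKD : (4 : ℝ) * r * (r + 1 + 544 * p ^ 2) ≤ D := by
    have : (4 : ℝ) * r * (r + 1 + 544 * p ^ 2) ≤ u := by exact_mod_cast hK
    linarith
  have hD1 : 1 ≤ D := by
    have : (0 : ℝ) ≤ u := by positivity
    linarith
  have hDn : D ^ 8 ≤ n := by
    have h1 : (2 ^ u) ^ 8 ≤ n := by
      rw [← pow_mul]
      refine (Nat.pow_le_pow_right (by norm_num) ?_).trans (Nat.pow_log_le_self 2 (by omega))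
      omega
    rw [hD]
    exact_mod_cast h1
  have hLD : (cliqueBound p n : ℝ) ≤ 17 * p * D := by
    have h1 : cliqueBound p n ≤ 17 * p * (u + 1) := by
      have h2 : Nat.log 2 n + 1 ≤ 8 * (u + 1) := by omega
      have h3 : 2 * p * (Nat.log 2 n + 1) ≤ 2 * p * (8 * (u + 1)) := by gcongr
      have h4 : 1 ≤ p * (u + 1) := Nat.mul_pos hp (Nat.succ_pos u)
      rw [cliqueBound]
      linarith
    calc (cliqueBound p n : ℝ) ≤ 17 * p * (u + 1) := by exact_mod_cast h1
      _ ≤ _ := by gcongr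
  have hA0 : 0 < (n : ℝ) / (4 * D) := by positivity
  have h1 : 4 * (p : ℝ) * (n + 1) * cliqueBound p n / A ≤ 544 * p ^ 2 * D ^ 2 :=
    calc 4 * (p : ℝ) * (n + 1) * cliqueBound p n / A
        ≤ 4 * p * (n + n) * (17 * p * D) / (n / (4 * D)) := by gcongr
      _ = _ := by field_simp; ring
  have h2 : D ^ 7 / 4 * (p / r) ≤ A * (p / r) := by
    gcongr
    refine le_trans ?_ hA
    rw [div_le_div_iff₀ (by norm_num) (by positivity)]
    linarith
  have h3 : (r : ℝ) + 1 + 544 * p ^ 2 * D ^ 2 ≤ D ^ 7 / 4 * (p / r) := by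
    rw [← mul_div_assoc, le_div_iff₀ hr0]
    have hD2 : 1 ≤ D ^ 2 := one_le_pow₀ hD1
    have h4 : (r : ℝ) + 1 + 544 * p ^ 2 * D ^ 2 ≤ (r + 1 + 544 * p ^ 2) * D ^ 2 := by nlinarith
    have h5 : D ^ 3 ≤ D ^ 7 := pow_le_pow_right₀ hD1 (by norm_num)
    have h6 : D ^ 7 / 4 ≤ D ^ 7 / 4 * p := le_mul_of_one_le_right (by positivity) hp'
    have h7 : (4 : ℝ) * r * (r + 1 + 544 * p ^ 2) * D ^ 2 ≤ D * D ^ 2 := by gcongr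
    have h8 := mul_le_mul_of_nonneg_right h4 hr0.le
    linarith
  linarith

lemma two_mul_choose_lt {p n : ℕ} (hp : 1 ≤ p) :
    (2 : ℝ) * n.choose (cliqueBound p n) <
      (2 : ℝ) ^ (((cliqueBound p n).choose 2 : ℝ) / p) := by
  have hp' : (0 : ℝ) < p := by exact_mod_cast hp
  have hexp : (((cliqueBound p n).choose 2 : ℝ) / p) =
      (((Nat.log 2 n + 1) * cliqueBound p n : ℕ) : ℝ) := by
    rw [Nat.cast_choose_two, cliqueBound]
    push_cast
    field_simp
    ring
  rw [hexp, Real.rpow_natCast]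
  have hL2 : 2 ≤ cliqueBound p n := by
    have : 1 ≤ p * (Nat.log 2 n + 1) := Nat.mul_pos hp (Nat.succ_pos _)
    rw [cliqueBound]
    linarith
  have h1 : 2 * n.choose (cliqueBound p n) ≤ n ^ cliqueBound p n :=
    calc 2 * n.choose (cliqueBound p n)
        ≤ (cliqueBound p n).factorial * n.choose (cliqueBound p n) := by
          gcongr
          exact hL2.trans (Nat.self_le_factorial _)
      _ = n.descFactorial (cliqueBound p n) := (Nat.descFactorial_eq_factorial_mul_choose _ _).symm
      _ ≤ _ := Nat.descFactorial_le_pow _ _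
  have h2 : n ^ cliqueBound p n < 2 ^ ((Nat.log 2 n + 1) * cliqueBound p n) := by
    rw [pow_mul]
    exact Nat.pow_lt_pow_left (Nat.lt_pow_succ_log_self (by norm_num) n) (by omega)
  exact_mod_cast h1.trans_lt h2

/-! ### From an invariant to a strategy. -/

section Strategy

variable {V : Type*} [Fintype V] [DecidableEq V] (G : SimpleGraph V) [DecidableRel G.Adj]

lemma exists_isMove_superset {q : ℕ} {P : Position V} {X : Finset (Sym2 V)}
    (hX : X ⊆ uncoloured G P) (hq : #X ≤ q) : ∃ B, X ⊆ B ∧ IsMove G q P B := by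
  obtain ⟨B, hXB, hB, hcard⟩ := exists_subsuperset_card_eq hX
    (le_min hq (card_le_card hX)) (min_le_right q _)
  exact ⟨B, hXB, hB, hcard⟩

/-- Bob wins if he can maintain an invariant that forces a win at the end. -/
lemma secondPlayerWins_of_invariant {p q : ℕ} (I : Position V → Prop) (hstart : I ⟨∅, ∅⟩)
    (hstep : ∀ P M, I P → IsMove G p P M →
      ∃ B, IsMove G q (P.addRed M) B ∧ I ((P.addRed M).addBlue B))
    (hend : ∀ P, I P → uncoloured G P = ∅ →
      (SimpleGraph.fromEdgeSet (P.red : Set (Sym2 V))).cliqueNum <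
        (SimpleGraph.fromEdgeSet (P.blue : Set (Sym2 V))).cliqueNum) :
    SecondPlayerWins G p q := by
  -- Strategies see only the position: the move keeps the invariant whenever some legal move does,
  -- and is an arbitrary legal one otherwise.
  have hmove : ∀ Q : Position V, ∃ B, IsMove G q Q B ∧
      ((∃ B', IsMove G q Q B' ∧ I (Q.addBlue B')) → I (Q.addBlue B)) := by
    intro Q
    by_cases h : ∃ B', IsMove G q Q B' ∧ I (Q.addBlue B')
    · obtain ⟨B', hB', hI⟩ := h
      exact ⟨B', hB', fun _ => hI⟩
    · obtain ⟨B, -, hB⟩ := exists_isMove_superset G (q := q) (empty_subset (uncoloured G Q))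
        (by simp)
      exact ⟨B, hB, fun h' => absurd h' h⟩
  choose σ hσ hI using hmove
  refine ⟨σ, hσ, fun P hP => hend P ?_⟩
  induction hP with
  | start => exact hstart
  | round P M _ hM ih => exact hI _ (hstep P M ih hM)

end Strategy

/-! ### Clique numbers, and the two games combined. -/

section Clique

variable {V : Type*} [DecidableEq V]

/-- The edges of the complete graph on `A`. -/
def cliqueEdges (A : Finset V) : Finset (Sym2 V) := A.offDiag.image fun x => s(x.1, x.2)

lemma card_cliqueEdges (A : Finset V) : #(cliqueEdges A) = (#A).choose 2 :=
  Sym2.card_image_offDiag A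

lemma cliqueNum_fromEdgeSet_lt {L : ℕ} {R : Finset (Sym2 V)}
    (h : ∀ A : Finset V, #A = L → ¬ cliqueEdges A ⊆ R) :
    (SimpleGraph.fromEdgeSet (R : Set (Sym2 V))).cliqueNum < L := by
  by_contra! hL
  obtain ⟨K, hK⟩ := (SimpleGraph.fromEdgeSet (R : Set (Sym2 V))).exists_isNClique_cliqueNum
  obtain ⟨A, hAK, hA⟩ := exists_subset_card_eq (hL.trans hK.card_eq.ge)
  refine h A hA fun e he => ?_
  obtain ⟨⟨x, y⟩, hxy, rfl⟩ := mem_image.1 he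
  rw [mem_offDiag] at hxy
  have := hK.isClique (hAK hxy.1) (hAK hxy.2.1) hxy.2.2
  exact ((SimpleGraph.fromEdgeSet_adj _).1 this).1

end Clique

lemma card_le_cliqueNum_fromEdgeSet {V : Type*} [Fintype V] {B : Finset (Sym2 V)} {S : Finset V}
    (h : ∀ x ∈ S, ∀ y ∈ S, x ≠ y → s(x, y) ∈ B) :
    #S ≤ (SimpleGraph.fromEdgeSet (B : Set (Sym2 V))).cliqueNum :=
  SimpleGraph.IsClique.card_le_cliqueNum (t := S) (tc := fun x hx y hy hxy =>
    (SimpleGraph.fromEdgeSet_adj _).2 ⟨h x hx y hy hxy, hxy⟩)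

/-- Bob wins with one edge of each turn spent on keeping Alice's cliques small, and the other `r`
edges spent on building a clique of his own. -/
lemma secondPlayerWins_top {V : Type*} [Fintype V] [DecidableEq V] {p r : ℕ} (hp : 1 ≤ p)
    (hr : 100 * p ^ 2 ≤ r)
    (hn : 2 ^ (8 * (4 * r * (r + 1 + 544 * p ^ 2))) ≤ Fintype.card V) :
    SecondPlayerWins (⊤ : SimpleGraph V) p (r + 1) := by
  set n := Fintype.card V with hcard
  have hr1 : 1 ≤ r := by nlinarith
  have hrn : r ≤ n := by
    refine le_trans ?_ hn
    refine (Nat.lt_two_pow_self (n := r)).le.trans (Nat.pow_le_pow_right (by norm_num) ?_)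
    nlinarith [Nat.zero_le (p ^ 2), mul_le_mul hr1 hr1]
  have hn1 : 1 ≤ n := hr1.trans hrn
  set L := cliqueBound p n with hLdef
  have hL1 : 1 < L := by
    have : 1 ≤ p * (Nat.log 2 n + 1) := Nat.mul_pos hp (Nat.succ_pos _)
    rw [hLdef, cliqueBound]
    linarith
  have ha := target_succ_le hp hr hn1 (target_cliqueBound_large hp hr hn)
  let F : Finset (Finset (Sym2 V)) := (powersetCard L univ).image cliqueEdges
  let E : Finset (Sym2 V) := (⊤ : SimpleGraph V).edgeFinset
  refine secondPlayerWins_of_invariant _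
    (fun P => Disjoint P.red P.blue ∧ Safe F E p (2 * #F) P.red P.blue ∧
      ∃ τ, Building p r n L (target p r n) P τ)
    ⟨disjoint_empty_left _, safe_empty F E p, 0,
      building_start rfl hn1 hL1 (target_one_le hp hr1 hrn)⟩ ?_ ?_
  · rintro P M ⟨hdisj, hsafe, τ, hbuild⟩ ⟨hMP, hMcard⟩
    have hMp : #M ≤ p := hMcard.trans_le (min_le_left _ _)
    obtain ⟨Y, hY, hY1, hsafe'⟩ := hsafe.step hp hMP hMp
    obtain ⟨X, hX, hXr, hbuild'⟩ := hbuild.step hr1 rfl hMp ha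
    -- `X` and `Y` may overlap or be small; the move is padded to legal size, which harms neither
    -- game.
    obtain ⟨B, hB, hBmove⟩ := exists_isMove_superset ⊤ (q := r + 1)
      (union_subset hX (show Y ⊆ uncoloured ⊤ (P.addRed M) from hY))
      ((card_union_le X Y).trans (add_le_add hXr hY1))
    refine ⟨B, hBmove, ?_, ?_, τ + 1, hbuild' B (union_subset_left hB)⟩
    · change Disjoint (P.red ∪ M) (P.blue ∪ B)
      rw [disjoint_union_left, disjoint_union_right, disjoint_union_right]
      have hM : Disjoint M (P.red ∪ P.blue) := disjoint_sdiff.symm.mono_left hMP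
      have hB' : Disjoint B (P.red ∪ M ∪ P.blue) := disjoint_sdiff.symm.mono_left hBmove.1
      rw [disjoint_union_right] at hM hB'
      rw [disjoint_union_right] at hB'
      exact ⟨⟨hdisj, hB'.1.1.symm⟩, hM.2, hB'.1.2.symm⟩
    · exact hsafe' _ subset_union_left ((union_subset_right hB).trans subset_union_right)
  · rintro P ⟨hdisj, hsafe, τ, hbuild⟩ hP
    obtain ⟨S, hS, hclique⟩ := hbuild.exists_clique hr1 rfl ha hP
    refine (cliqueNum_fromEdgeSet_lt (L := L) fun A hA => ?_).trans_le
      (hS.ge.trans (card_le_cliqueNum_fromEdgeSet hclique))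
    refine hsafe.not_subset hdisj
      (mem_image_of_mem _ (mem_powersetCard.2 ⟨subset_univ _, hA⟩)) ?_
    rw [card_cliqueEdges, hA]
    refine lt_of_le_of_lt ?_ (two_mul_choose_lt hp)
    have : #F ≤ n.choose L :=
      card_image_le.trans (by rw [card_powersetCard, card_univ])
    gcongr

end CliqueGame

theorem mainTheorem3 :
    ∃ c : ℝ, 0 < c ∧ ∀ p q : ℕ, 1 ≤ p → c * (p : ℝ) ^ 2 < (q : ℝ) →
      ∃ n₀ : ℕ, ∀ n : ℕ, n₀ ≤ n →
        CliqueGame.SecondPlayerWins (⊤ : SimpleGraph (Fin n)) p q := by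
  refine ⟨100, by norm_num, fun p q hp hq => ?_⟩
  have hq' : 100 * p ^ 2 < q := by exact_mod_cast hq
  obtain ⟨r, rfl⟩ : ∃ r, q = r + 1 := ⟨q - 1, by omega⟩
  refine ⟨2 ^ (8 * (4 * r * (r + 1 + 544 * p ^ 2))), fun n hn => ?_⟩
  exact CliqueGame.secondPlayerWins_top hp (Nat.lt_succ_iff.1 hq') (by rwa [Fintype.card_fin])
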